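/- \textbf{Setting.} Let $\mathcal X\subseteq\mathbb R^d$, $\theta_0\in\mathbb R^d$, $\alpha_0>0$, $0\le\underline p<\overline p\le 1$, $f:\mathbb R\to\mathbb R$, and let $P_{\mathcal X}$ be a probability measure on $\mathbb R^d$ with $P_{\mathcal X}$-almost every $x$ in $\mathcal X$. For a utility $u$ and a price $p$ put $r_u(p)=p\,f(u-\alpha_0p)$, and let $P_{\mathcal U}$ be the law of $x^\top\theta_0$ under $x\sim P_{\mathcal X}$. Assume that there are constants $B\le\tilde B<\infty$, $L_f,L_U<\infty$ and $\sigma_r>0$ such that: (A1) for all $x\in\mathcal X$ and $p\in[\underline p,\overline p]$: $x^\top\theta_0\in[-B,B]$, $x^\top\theta_0-\alpha_0p\in[-\tilde B,\tilde B]$ and $f(x^\top\theta_0-\alpha_0p)\in[0,1]$; (A2) $f$ is twice continuously differentiable on $[-\tilde B,\tilde B]$ (one-sided derivatives at the end points) with $|f|,|f'|,|f''|\le L_f$ there; and for every $u\in I$, with $I$ as in (A3), there is $p^*(u)\in(\underline p,\overline p)$ such that $r_u$ is non-decreasing on $[\underline p,p^*(u)]$, non-increasing on $[p^*(u),\overline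 p]$, and $r_u(p)\le r_u(p^*(u))-\frac{\sigma_r}{2}(p-p^*(u))^2$ for all $p\in[\underline p,\overline p]$ (thus $p^*(u)$ is the unique maximizer of $r_u$ on $[\underline p,\overline p]$, the unconstrained optimal price); (A3) the support $I$ of $P_{\mathcal U}$ is a compact interval contained in $[-B,B]$, and $P_{\mathcal U}(U)\le L_U|U|/(2B)$ for every measurable $U\subseteq[-B,B]$, where $|U|$ is Lebesgue measure. Let $$\sigma_u=\inf_{v\in[-\tilde B,\tilde B]}\big\{f'(v)-\alpha_0\overline p\,|f''(v)|\big\},\qquad M_r=\sup_{u\in I,\;p\in[\underline p,\overline p]}|r_u''(p)|,$$ where $r_u''$ is the second derivative in $p$. For $\delta_0>0$, a policy $\pi:\mathcal X\to[\underline p,\overline p]$ is $\delta_0$-utility fair ($\delta_0$-UF) if $|\pi(x)-\pi(x')|\le\delta_0|(x-x')^\top\theta_0|$ for all $x,x'\in\mathcal X$; it is optimal if it maximizes $\mathbb E_{x\sim P_{\mathcal X}}[r_{x^\top\theta_0}(\pi(x))]$ among all $\delta_0$-UF policies. \textbf{Theorem.} Assume (A1)--(A3), $\sigma_u>0$ and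 $\delta_0>0$. Let $\varpi^*$ be a real function whose restriction to $I$ is $\delta_0$-Lipschitz with values in $[\underline p,\overline p]$ and such that $\pi^*(x)=\varpi^*(x^\top\theta_0)$ is an optimal $\delta_0$-UF policy, and assume that the optimal policy is unique, in the sense that every optimal $\delta_0$-UF policy equals $\pi^*$ $P_{\mathcal X}$-almost everywhere. Then: 1. $\varpi^*$ is non-decreasing on $I$. 2. $\varpi^*$ is differentiable at Lebesgue-almost every $u\in I$; and $\varpi^*(u)=p^*(u)$ for every $u$ in the interior of $I$ at which $\varpi^*$ is differentiable with $\partial_u\varpi^*(u)<\delta_0$. 3. If moreover $\delta_0\le\sigma_u/M_r$, then there is $\pi_0\in\mathbb R$ with $\varpi^*(u)=\pi_0+\delta_0u$ for all $u\in I$; and if $0\in I$, then $\pi_0=\varpi^*(0)\in[\underline p,\overline p]$. -/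

import Mathlib

open Set MeasureTheory

/-- The data of a contextual pricing problem with `d`-dimensional contexts: a customer with context
`x` who is offered the price `p ∈ [pLow, pHigh]` has expected demand `link (⟪x, θ₀⟫ - α₀ * p)`.
The standing assumptions on these data are stated separately below. -/
structure PricingModel (d : ℕ) where
  /-- the set of contexts -/
  contexts : Set (EuclideanSpace ℝ (Fin d))
  /-- the distribution of the context of a customer -/
  contextLaw : Measure (EuclideanSpace ℝ (Fin d))
  /-- the linear model of the baseline utility -/
  θ₀ : EuclideanSpace ℝ (Fin d)
  /-- the price elasticity -/
  α₀ : ℝ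
  /-- the link function `f` -/
  link : ℝ → ℝ
  /-- the lowest admissible price -/
  pLow : ℝ
  /-- the highest admissible price -/
  pHigh : ℝ
  /-- the bound on baseline utilities -/
  B : ℝ
  /-- the bound on the arguments of the link function -/
  Btilde : ℝ

noncomputable section

namespace PricingModel

variable {d : ℕ} (M : PricingModel d)

/-- The interval of admissible prices. -/
def prices : Set ℝ := Icc M.pLow M.pHigh

/-- The interval `[-B̃, B̃]` of arguments of the link function. -/
def linkDomain : Set ℝ := Icc (-M.Btilde) M.Btilde

/-- The baseline utility `x ↦ xᵀθ₀` of a context. -/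
def utility (x : EuclideanSpace ℝ (Fin d)) : ℝ := inner ℝ x M.θ₀

/-- The distribution of the baseline utility. -/
def utilityLaw : Measure ℝ := M.contextLaw.map M.utility

/-- The (topological) support of the distribution of the baseline utility. -/
def utilityRange : Set ℝ := M.utilityLaw.support

/-- The expected revenue `r_u(p) = p f(u - α₀ p)`. -/
def revenue (u p : ℝ) : ℝ := p * M.link (u - M.α₀ * p)

/-- The unconstrained optimal price `p*(u)`: a maximizer of `r_u` over the admissible prices. -/
def optimalPrice (u : ℝ) : ℝ :=
  Classical.epsilon fun p => p ∈ M.prices ∧ IsMaxOn (M.revenue u) M.prices p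

/-- Boundedness of utilities, link arguments and expected demands (and the conventions on the
prices and on the sign of the elasticity). -/
structure Bounded : Prop where
  pLow_nonneg : 0 ≤ M.pLow
  pLow_lt_pHigh : M.pLow < M.pHigh
  pHigh_le_one : M.pHigh ≤ 1
  α₀_pos : 0 < M.α₀
  B_le_Btilde : M.B ≤ M.Btilde
  utility_mem : ∀ x ∈ M.contexts, M.utility x ∈ Icc (-M.B) M.B
  link_arg_mem : ∀ x ∈ M.contexts, ∀ p ∈ M.prices, M.utility x - M.α₀ * p ∈ M.linkDomain
  link_mem : ∀ x ∈ M.contexts, ∀ p ∈ M.prices, M.link (M.utility x - M.α₀ * p) ∈ Icc (0 : ℝ) 1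

/-- The link function is twice continuously differentiable with bounded derivatives, and for every
utility `u` in the support the revenue `r_u` is unimodal with a strictly interior maximizer `p*(u)`,
away from which it decays at least quadratically (so that the maximizer is unique). -/
structure SmoothUnimodal : Prop where
  contDiffOn : ContDiffOn ℝ 2 M.link M.linkDomain
  bounded : ∃ Lf : ℝ, ∀ v ∈ M.linkDomain, |M.link v| ≤ Lf ∧
    |derivWithin M.link M.linkDomain v| ≤ Lf ∧ |iteratedDerivWithin 2 M.link M.linkDomain v| ≤ Lf
  interior : ∀ u ∈ M.utilityRange, M.optimalPrice u ∈ Ioo M.pLow M.pHigh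
  increasing : ∀ u ∈ M.utilityRange, MonotoneOn (M.revenue u) (Icc M.pLow (M.optimalPrice u))
  decreasing : ∀ u ∈ M.utilityRange, AntitoneOn (M.revenue u) (Icc (M.optimalPrice u) M.pHigh)
  decay : ∃ σr : ℝ, 0 < σr ∧ ∀ u ∈ M.utilityRange, ∀ p ∈ M.prices,
    M.revenue u p ≤ M.revenue u (M.optimalPrice u) - σr / 2 * (p - M.optimalPrice u) ^ 2

/-- The contexts are distributed on the context set, the baseline utility is supported on a compact
interval contained in `[-B, B]`, and its distribution has density at most `L_U / (2B)`. -/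
structure Stochastic : Prop where
  isProbabilityMeasure : IsProbabilityMeasure M.contextLaw
  ae_mem : ∀ᵐ x ∂M.contextLaw, x ∈ M.contexts
  support_eq : ∃ a b : ℝ, a ≤ b ∧ M.utilityRange = Icc a b ∧ Icc a b ⊆ Icc (-M.B) M.B
  density : ∃ LU : ℝ, ∀ U : Set ℝ, MeasurableSet U → U ⊆ Icc (-M.B) M.B →
    M.utilityLaw U ≤ ENNReal.ofReal (LU / (2 * M.B)) * volume U

/-- `σ_u`, the infimum of `f'(v) - α₀ p̄ |f''(v)|` over `v ∈ [-B̃, B̃]`. -/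
def sigmaU : ℝ :=
  sInf ((fun v => derivWithin M.link M.linkDomain v -
    M.α₀ * M.pHigh * |iteratedDerivWithin 2 M.link M.linkDomain v|) '' M.linkDomain)

/-- `M_r`, the supremum of `|r_u''(p)|` (second derivative in the price) over all utilities `u` in
the support and all admissible prices `p`. -/
def Mr : ℝ :=
  sSup ((fun q : ℝ × ℝ => |iteratedDerivWithin 2 (M.revenue q.1) M.prices q.2|) ''
    (M.utilityRange ×ˢ M.prices))

/-- A contextual pricing policy is `δ`-utility fair if it posts admissible prices and prices
differ by at most `δ` times the difference of the baseline utilities. -/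
def IsUtilityFair (δ : ℝ) (π : EuclideanSpace ℝ (Fin d) → ℝ) : Prop :=
  (∀ x ∈ M.contexts, π x ∈ M.prices) ∧
    ∀ x ∈ M.contexts, ∀ x' ∈ M.contexts, |π x - π x'| ≤ δ * |M.utility x - M.utility x'|

/-- The expected revenue of a contextual pricing policy. -/
def expectedRevenue (π : EuclideanSpace ℝ (Fin d) → ℝ) : ℝ :=
  ∫ x, M.revenue (M.utility x) (π x) ∂M.contextLaw

/-- `π` maximizes the expected revenue among all `δ`-utility fair policies. -/
def IsOptimalFair (δ : ℝ) (π : EuclideanSpace ℝ (Fin d) → ℝ) : Prop :=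
  M.IsUtilityFair δ π ∧
    ∀ π', M.IsUtilityFair δ π' → M.expectedRevenue π' ≤ M.expectedRevenue π

/-- The class of admissible `δ`-Lipschitz functions of the baseline utility. -/
def fairClass (δ : ℝ) : Set (ℝ → ℝ) :=
  {g | (∀ u ∈ M.utilityRange, g u ∈ M.prices) ∧
    ∀ u ∈ M.utilityRange, ∀ u' ∈ M.utilityRange, |g u - g u'| ≤ δ * |u - u'|}

end PricingModel

end

/-! The argument separates a variational fact from one-variable geometry. Let `g` be `δ`-Lipschitz
and pointwise between the optimal price `q = p*` and `ϖ`. By unimodality `g` earns at least as much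
as `ϖ` at every utility in the support, so it is optimal too; uniqueness and continuity then force
`g = ϖ` on the support. This rigidity (`PricingModel.isRigid_of_isOptimalFair`) is all that is kept
of optimality.

The three claims follow by choosing competitors `g`. Cutting `ϖ` at a barrier that is flat and then
rises with slope `δ` gives monotonicity, and also `ϖ = q` wherever the slope of `ϖ` is below `δ`
(there `ϖ` could be moved towards `q`). If `q` grows at rate at least `δ`, a line of slope `δ` is
itself a competitor, so `ϖ` is that line.

What is needed of `q` comes from the marginal revenue, which vanishes at `q u`, increases in the
utility at rate at least `σ_u`, and is `M_r`-Lipschitz in the price. Hence `q` is monotone with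
slope at least `σ_u / M_r`; its continuity comes from the quadratic decay. -/

/-- `ϖ` is rigid relative to `q` on `[a, b]`: the only `δ`-Lipschitz function lying pointwise
between `q` and `ϖ` is `ϖ` itself. -/
def IsRigid (a b δ : ℝ) (q ϖ : ℝ → ℝ) : Prop :=
  ∀ g : ℝ → ℝ, (∀ u ∈ Icc a b, ∀ v ∈ Icc a b, |g u - g v| ≤ δ * |u - v|) →
    (∀ u ∈ Icc a b, g u ∈ uIcc (q u) (ϖ u)) → ∀ u ∈ Icc a b, g u = ϖ u

theorem neg_mem_Icc_neg {a b u : ℝ} (hu : u ∈ Icc (-b) (-a)) : -u ∈ Icc a b :=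
  ⟨by linarith [hu.2], by linarith [hu.1]⟩

/-! ### Consequences of rigidity for functions on an interval -/

namespace IsRigid

variable {a b δ : ℝ} {q ϖ : ℝ → ℝ}

/-- The point reflection of the graph through the origin preserves the hypotheses on `q` and `ϖ`, so
every upper bound below also yields a lower bound. -/
theorem reflect (h : IsRigid a b δ q ϖ) :
    IsRigid (-b) (-a) δ (fun u => -q (-u)) (fun u => -ϖ (-u)) := by
  intro g hg hgm u hu
  have key := h (fun u => -g (-u)) (fun u hu v hv => ?_) (fun u hu => ?_) (-u) (neg_mem_Icc_neg hu)
  · simp only [neg_neg] at key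
    linarith
  · have := hg (-u) (by constructor <;> linarith [hu.1, hu.2])
      (-v) (by constructor <;> linarith [hv.1, hv.2])
    rw [show -g (-u) - -g (-v) = -(g (-u) - g (-v)) by ring, abs_neg]
    rwa [show -u - -v = -(u - v) by ring, abs_neg (u - v)] at this
  · have := hgm (-u) (by constructor <;> linarith [hu.1, hu.2])
    simp only [neg_neg, mem_uIcc] at this ⊢
    rcases this with h | h
    · right; constructor <;> linarith [h.1, h.2]
    · left; constructor <;> linarith [h.1, h.2]

/-- A rigid function lies below every barrier `c + δ (u - t)⁺` that does not undercut `q` where it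
undercuts `ϖ`. -/
theorem le_of_barrier (h : IsRigid a b δ q ϖ) (hδ : 0 ≤ δ)
    (hϖ : ∀ u ∈ Icc a b, ∀ v ∈ Icc a b, |ϖ u - ϖ v| ≤ δ * |u - v|) {t c : ℝ}
    (hc : ∀ u ∈ Icc a b, c + δ * max (u - t) 0 < ϖ u → q u ≤ c + δ * max (u - t) 0)
    {u : ℝ} (hu : u ∈ Icc a b) : ϖ u ≤ c + δ * max (u - t) 0 := by
  -- The competitor is `ϖ` cut off at the barrier: `δ`-Lipschitz as a minimum of two such functions,
  -- and between `q` and `ϖ` by `hc`.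
  have key := h (fun u => min (ϖ u) (c + δ * max (u - t) 0)) (fun u hu v hv => ?_)
    (fun u hu => ?_) u hu
  · exact min_eq_left_iff.mp key
  · refine (abs_min_sub_min_le_max _ _ _ _).trans (max_le (hϖ u hu v hv) ?_)
    have : |max (u - t) 0 - max (v - t) 0| ≤ |(u - t) - (v - t)| := abs_max_sub_max_le_abs _ _ _
    rw [show c + δ * max (u - t) 0 - (c + δ * max (v - t) 0)
      = δ * (max (u - t) 0 - max (v - t) 0) by ring, abs_mul, abs_of_nonneg hδ]
    exact mul_le_mul_of_nonneg_left (by simpa using this) hδ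
  · rcases le_or_gt (ϖ u) (c + δ * max (u - t) 0) with h1 | h1
    · simp [min_eq_left h1]
    · simp only [min_eq_right h1.le]
      exact mem_uIcc_of_le (hc u hu h1) h1.le

/-- Take a barrier with its kink at `v` and height `max (ϖ v) (q v)`. Left of `v` it dominates `q`
because `q` is monotone; right of `v` it dominates `ϖ` because `ϖ` is Lipschitz. -/
theorem le_max (h : IsRigid a b δ q ϖ) (hδ : 0 ≤ δ)
    (hϖ : ∀ u ∈ Icc a b, ∀ v ∈ Icc a b, |ϖ u - ϖ v| ≤ δ * |u - v|)
    (hq : MonotoneOn q (Icc a b)) {u v : ℝ} (hu : u ∈ Icc a b) (hv : v ∈ Icc a b) (huv : u ≤ v) :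
    ϖ u ≤ max (ϖ v) (q v) := by
  have key := h.le_of_barrier hδ hϖ (t := v) (c := max (ϖ v) (q v)) (fun w hw hlt => ?_) hu
  · simpa [max_eq_right (sub_nonpos.mpr huv)] using key
  · rcases le_total w v with hwv | hwv
    · simpa [max_eq_right (sub_nonpos.mpr hwv)] using Or.inr (hq hw hv hwv)
    · exfalso
      have h1 := (le_abs_self _).trans (hϖ w hw v hv)
      rw [abs_of_nonneg (sub_nonneg.mpr hwv)] at h1
      rw [max_eq_left (sub_nonneg.mpr hwv)] at hlt
      linarith [le_max_left (ϖ v) (q v)]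

theorem lipschitz_reflect
    (hϖ : ∀ u ∈ Icc a b, ∀ v ∈ Icc a b, |ϖ u - ϖ v| ≤ δ * |u - v|) :
    ∀ u ∈ Icc (-b) (-a), ∀ v ∈ Icc (-b) (-a), |-ϖ (-u) - -ϖ (-v)| ≤ δ * |u - v| := by
  intro u hu v hv
  have := hϖ _ (neg_mem_Icc_neg hv) _ (neg_mem_Icc_neg hu)
  rwa [show -v - -u = u - v by ring,
    show ϖ (-v) - ϖ (-u) = -ϖ (-u) - -ϖ (-v) by ring] at this

theorem monotoneOn_reflect (hq : MonotoneOn q (Icc a b)) :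
    MonotoneOn (fun u => -q (-u)) (Icc (-b) (-a)) := fun _ hu _ hv huv =>
  neg_le_neg (hq (neg_mem_Icc_neg hv) (neg_mem_Icc_neg hu) (neg_le_neg huv))

theorem min_le (h : IsRigid a b δ q ϖ) (hδ : 0 ≤ δ)
    (hϖ : ∀ u ∈ Icc a b, ∀ v ∈ Icc a b, |ϖ u - ϖ v| ≤ δ * |u - v|)
    (hq : MonotoneOn q (Icc a b)) {u v : ℝ} (hu : u ∈ Icc a b) (hv : v ∈ Icc a b) (huv : u ≤ v) :
    min (ϖ u) (q u) ≤ ϖ v := by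
  have key := h.reflect.le_max hδ (lipschitz_reflect hϖ) (monotoneOn_reflect hq)
    (u := -v) (v := -u) (by constructor <;> linarith [hv.1, hv.2])
    (by constructor <;> linarith [hu.1, hu.2]) (neg_le_neg huv)
  simp only [neg_neg, max_neg_neg] at key
  linarith

theorem lipschitzOnWith (hδ : 0 ≤ δ)
    (hϖ : ∀ u ∈ Icc a b, ∀ v ∈ Icc a b, |ϖ u - ϖ v| ≤ δ * |u - v|) :
    LipschitzOnWith ⟨δ, hδ⟩ ϖ (Icc a b) :=
  LipschitzOnWith.of_dist_le_mul fun u hu v hv => by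
    rw [Real.dist_eq, Real.dist_eq]; exact hϖ u hu v hv

theorem monotoneOn (h : IsRigid a b δ q ϖ) (hδ : 0 ≤ δ)
    (hϖ : ∀ u ∈ Icc a b, ∀ v ∈ Icc a b, |ϖ u - ϖ v| ≤ δ * |u - v|)
    (hq : MonotoneOn q (Icc a b)) (hqc : ContinuousOn q (Icc a b)) :
    MonotoneOn ϖ (Icc a b) := by
  intro u hu v hv huv
  by_contra! hlt
  have h1 := h.le_max hδ hϖ hq hu hv huv
  have h2 := h.min_le hδ hϖ hq hu hv huv
  -- If `ϖ` dropped from `u` to `v`, these bounds would put `ϖ` above `q` at `u` and below it at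
  -- `v`. At a crossing `w` the two lemmas collapse to `ϖ u ≤ ϖ w ≤ ϖ v`.
  have h3 : ϖ u ≤ q v := by
    rcases le_max_iff.mp h1 with h | h
    · linarith
    · exact h
  have h4 : q u ≤ ϖ v := by
    rcases min_le_iff.mp h2 with h | h
    · linarith
    · exact h
  have hsub : Icc u v ⊆ Icc a b := Icc_subset_Icc hu.1 hv.2
  have hc : ContinuousOn (fun w => ϖ w - q w) (Icc u v) :=
    ((lipschitzOnWith hδ hϖ).continuousOn.sub hqc).mono hsub
  obtain ⟨w, hw, hw0⟩ := intermediate_value_Icc' huv hc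
    (show (0 : ℝ) ∈ Icc (ϖ v - q v) (ϖ u - q u) from ⟨by linarith, by linarith⟩)
  have hwq : ϖ w = q w := by simpa [sub_eq_zero] using hw0
  have h5 := h.le_max hδ hϖ hq hu (hsub hw) hw.1
  have h6 := h.min_le hδ hϖ hq (hsub hw) hv hw.2
  rw [← hwq, max_self] at h5
  rw [← hwq, min_self] at h6
  linarith

/-- If `ϖ u₀ > q u₀`, a barrier with kink at `u₀` starting slightly below `ϖ u₀` is admissible: near
`u₀` and to its left it stays above `q`. Further right, `ϖ` has fallen behind the line of slope `δ`
and cannot catch up. -/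
theorem le_of_deriv_lt (h : IsRigid a b δ q ϖ) (hδ : 0 ≤ δ)
    (hϖ : ∀ u ∈ Icc a b, ∀ v ∈ Icc a b, |ϖ u - ϖ v| ≤ δ * |u - v|)
    (hq : MonotoneOn q (Icc a b)) (hqc : ContinuousOn q (Icc a b)) {u₀ D : ℝ} (hu₀ : u₀ ∈ Ioo a b)
    (hd : HasDerivAt ϖ D u₀) (hD : D < δ) : ϖ u₀ ≤ q u₀ := by
  by_contra! hlt
  have hu₀' : u₀ ∈ Icc a b := Ioo_subset_Icc_self hu₀
  obtain ⟨δ', hD', hδ'⟩ := exists_between hD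
  obtain ⟨m, hm, hm'⟩ := exists_between hlt
  have hslope : ∀ᶠ u in nhdsWithin u₀ {u₀}ᶜ, slope ϖ u₀ u < δ' :=
    (hasDerivAt_iff_tendsto_slope.mp hd).eventually (gt_mem_nhds hD')
  have hqlt : ∀ᶠ u in nhds u₀, q u < m :=
    (hqc.continuousAt (Icc_mem_nhds hu₀.1 hu₀.2)).eventually (gt_mem_nhds hm)
  obtain ⟨η, hη, hball⟩ := Metric.eventually_nhds_iff.mp
    ((eventually_nhdsWithin_iff.mp hslope).and (hqlt.and (gt_mem_nhds hu₀.2)))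
  have hnear : ∀ u ∈ Icc u₀ (u₀ + η / 2), ϖ u ≤ ϖ u₀ + δ' * (u - u₀) ∧ q u < m ∧ u < b := by
    intro u hu
    obtain ⟨h1, h2, h3⟩ := hball (y := u) (by
      rw [Real.dist_eq, abs_of_nonneg (by linarith [hu.1])]; linarith [hu.2])
    refine ⟨?_, h2, h3⟩
    rcases hu.1.eq_or_lt with rfl | hlt
    · simp
    · have := h1 hlt.ne'
      rw [slope_def_field, div_lt_iff₀ (by linarith)] at this
      linarith
  -- This is how far `ϖ` lags behind slope `δ` after a distance `η / 2`; a smaller `ε` keeps the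
  -- barrier above `ϖ` from there on.
  have hε1 : 0 < (δ - δ') * (η / 2) := mul_pos (by linarith) (by linarith)
  obtain ⟨ε, hε, hε'⟩ := exists_between (lt_min (sub_pos.mpr hm') hε1)
  obtain ⟨hεm, hεη⟩ := lt_min_iff.mp hε'
  have key := h.le_of_barrier hδ hϖ (t := u₀) (c := ϖ u₀ - ε) (fun u hu hu1 => ?_) hu₀'
  · simp at key
    linarith
  · rcases le_total u u₀ with huu | huu
    · have := hq hu hu₀' huu
      rw [max_eq_right (by linarith)]
      linarith
    · rw [max_eq_left (by linarith)] at hu1 ⊢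
      have hpos : 0 ≤ δ * (u - u₀) := mul_nonneg hδ (by linarith)
      rcases le_total u (u₀ + η / 2) with hle | hle
      · linarith [(hnear u ⟨huu, hle⟩).2.1]
      · exfalso
        obtain ⟨h1, -, h3⟩ := hnear (u₀ + η / 2) ⟨by linarith, le_rfl⟩
        have h4 := (le_abs_self _).trans (hϖ u hu (u₀ + η / 2) ⟨by linarith [hu₀.1], h3.le⟩)
        rw [abs_of_nonneg (by linarith)] at h4
        nlinarith

theorem eq_of_deriv_lt (h : IsRigid a b δ q ϖ) (hδ : 0 ≤ δ)
    (hϖ : ∀ u ∈ Icc a b, ∀ v ∈ Icc a b, |ϖ u - ϖ v| ≤ δ * |u - v|)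
    (hq : MonotoneOn q (Icc a b)) (hqc : ContinuousOn q (Icc a b)) {u₀ D : ℝ} (hu₀ : u₀ ∈ Ioo a b)
    (hd : HasDerivAt ϖ D u₀) (hD : D < δ) : ϖ u₀ = q u₀ := by
  refine le_antisymm (h.le_of_deriv_lt hδ hϖ hq hqc hu₀ hd hD) ?_
  have hd' : HasDerivAt (fun u => -ϖ (-u)) D (-u₀) := by
    have h1 : HasDerivAt ϖ D (-(-u₀)) := by rwa [neg_neg]
    have h2 : HasDerivAt (fun u => -ϖ (-u)) (-(D * -1)) (-u₀) :=
      (h1.comp (-u₀) (hasDerivAt_neg (-u₀))).neg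
    rwa [show -(D * -1) = D by ring] at h2
  have key := h.reflect.le_of_deriv_lt hδ (lipschitz_reflect hϖ) (monotoneOn_reflect hq)
    (hqc.comp continuous_neg.continuousOn fun u hu => neg_mem_Icc_neg hu).neg
    (u₀ := -u₀) ⟨by linarith [hu₀.2], by linarith [hu₀.1]⟩ hd' hD
  simp only [neg_neg] at key
  linarith

/-- A rigid function is affine with slope `δ` if `q` grows at least at the rate `δ`. -/
theorem eq_affine (h : IsRigid a b δ q ϖ) (hδ : 0 ≤ δ)
    (hϖ : ∀ u ∈ Icc a b, ∀ v ∈ Icc a b, |ϖ u - ϖ v| ≤ δ * |u - v|) (hab : a ≤ b)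
    (hq : ∀ u ∈ Icc a b, ∀ v ∈ Icc a b, u ≤ v → δ * (v - u) ≤ q v - q u)
    (hqc : ContinuousOn q (Icc a b)) :
    ∃ c, ∀ u ∈ Icc a b, ϖ u = c + δ * u := by
  -- `t` is a crossing of `ϖ` and `q`, or an endpoint if there is none; the guards drop the
  -- inequality on the side where no points remain. The line of slope `δ` through `(t, ϖ t)` then
  -- separates `q` from `ϖ` on both sides of `t`.
  obtain ⟨t, ht, hl, hr⟩ : ∃ t ∈ Icc a b, (t < b → ϖ t ≤ q t) ∧ (a < t → q t ≤ ϖ t) := by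
    by_cases h1 : ϖ a ≤ q a
    · exact ⟨a, left_mem_Icc.mpr hab, fun _ => h1, fun h => (lt_irrefl a h).elim⟩
    by_cases h2 : q b ≤ ϖ b
    · exact ⟨b, right_mem_Icc.mpr hab, fun h => (lt_irrefl b h).elim, fun _ => h2⟩
    push Not at h1 h2
    have hc : ContinuousOn (fun w => ϖ w - q w) (Icc a b) :=
      (lipschitzOnWith hδ hϖ).continuousOn.sub hqc
    obtain ⟨w, hw, hw0⟩ := intermediate_value_Icc' hab hc
      (show (0 : ℝ) ∈ Icc (ϖ b - q b) (ϖ a - q a) from ⟨by linarith, by linarith⟩)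
    have hwq : ϖ w = q w := by simpa [sub_eq_zero] using hw0
    exact ⟨w, hw, fun _ => hwq.le, fun _ => hwq.ge⟩
  refine ⟨ϖ t - δ * t, fun u hu => (h (fun u => ϖ t - δ * t + δ * u) (fun u _ v _ => ?_)
    (fun u hu => ?_) u hu).symm⟩
  · rw [show ϖ t - δ * t + δ * u - (ϖ t - δ * t + δ * v) = δ * (u - v) by ring, abs_mul,
      abs_of_nonneg hδ]
  · rcases lt_trichotomy u t with hut | rfl | hut
    · have h1 := hr (hu.1.trans_lt hut)
      have h2 := hq u hu t ht hut.le
      have h3 := (le_abs_self _).trans (hϖ t ht u hu)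
      rw [abs_of_pos (by linarith)] at h3
      exact mem_uIcc_of_le (by linarith) (by linarith)
    · simp
    · have h1 := hl (hut.trans_le hu.2)
      have h2 := hq t ht u hu hut.le
      have h3 := (le_abs_self _).trans (hϖ u hu t ht)
      rw [abs_of_pos (by linarith)] at h3
      exact mem_uIcc_of_ge (by linarith) (by linarith)

end IsRigid

/-! ### From optimality and uniqueness to rigidity -/

namespace PricingModel

variable {d : ℕ} {M : PricingModel d}

theorem measurable_utility : Measurable M.utility :=
  (continuous_id.inner continuous_const).measurable

theorem ae_utility_mem_utilityRange : ∀ᵐ x ∂M.contextLaw, M.utility x ∈ M.utilityRange :=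
  ae_of_ae_map measurable_utility.aemeasurable (Measure.support_mem_ae (μ := M.utilityLaw))

/-- Every neighbourhood of a utility in the support is attained with positive probability. -/
theorem frequently_utility_mem {u : ℝ} (hu : u ∈ M.utilityRange) {U : Set ℝ} (hU : IsOpen U)
    (huU : u ∈ U) : ∃ᵐ x ∂M.contextLaw, M.utility x ∈ U := by
  have h := (Measure.mem_support_iff_forall u).mp hu U (hU.mem_nhds huU)
  rw [utilityLaw, Measure.map_apply measurable_utility hU.measurableSet] at h
  exact frequently_ae_iff.mpr h.ne'

/-- A closed condition satisfied by the utilities of all contexts holds on the support. -/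
theorem mem_of_forall_contexts (hS : M.Stochastic) {C : Set ℝ} (hC : IsClosed C)
    (h : ∀ x ∈ M.contexts, M.utility x ∈ C) {u : ℝ} (hu : u ∈ M.utilityRange) : u ∈ C := by
  by_contra hn
  obtain ⟨x, hx, hx'⟩ :=
    ((frequently_utility_mem hu hC.isOpen_compl hn).and_eventually hS.ae_mem).exists
  exact hx (h x hx')

theorem link_arg_mem_of_mem_utilityRange (hB : M.Bounded) (hS : M.Stochastic) {u p : ℝ}
    (hu : u ∈ M.utilityRange) (hp : p ∈ M.prices) : u - M.α₀ * p ∈ M.linkDomain :=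
  mem_of_forall_contexts hS
    (C := (fun u => u - M.α₀ * p) ⁻¹' M.linkDomain)
    (isClosed_Icc.preimage (by fun_prop)) (fun x hx => hB.link_arg_mem x hx p hp) hu

theorem continuousOn_revenue (hB : M.Bounded) (hU : M.SmoothUnimodal) (hS : M.Stochastic)
    {g : ℝ → ℝ} (hg : ContinuousOn g M.utilityRange) (hgm : ∀ u ∈ M.utilityRange, g u ∈ M.prices) :
    ContinuousOn (fun u => M.revenue u (g u)) M.utilityRange :=
  hg.mul (hU.contDiffOn.continuousOn.comp (continuousOn_id.sub (continuousOn_const.mul hg))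
    fun u hu => link_arg_mem_of_mem_utilityRange hB hS hu (hgm u hu))

theorem integrable_comp_utility (hS : M.Stochastic) {g : ℝ → ℝ}
    (hg : ContinuousOn g M.utilityRange) :
    Integrable (fun x => g (M.utility x)) M.contextLaw := by
  have := hS.isProbabilityMeasure
  obtain ⟨a, b, hab, hI, -⟩ := hS.support_eq
  rw [hI] at hg
  have hc : Continuous (IccExtend hab ((Icc a b).domRestrict g)) :=
    (continuousOn_iff_continuous_domRestrict.mp hg).Icc_extend'
  obtain ⟨K, hK⟩ := isCompact_Icc.exists_bound_of_continuousOn hg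
  have hae : ∀ᵐ x ∂M.contextLaw,
      IccExtend hab ((Icc a b).domRestrict g) (M.utility x) = g (M.utility x) := by
    filter_upwards [ae_utility_mem_utilityRange (M := M)] with x hx
    rw [hI] at hx
    rw [IccExtend_of_mem _ _ hx, domRestrict_apply]
  have hm : AEStronglyMeasurable (fun x => g (M.utility x)) M.contextLaw :=
    ((hc.measurable.comp measurable_utility).aestronglyMeasurable).congr hae
  refine Integrable.of_bound hm K ?_
  filter_upwards [ae_utility_mem_utilityRange (M := M)] with x hx
  exact hK _ (hI ▸ hx)

theorem optimalPrice_mem (hU : M.SmoothUnimodal) {u : ℝ} (hu : u ∈ M.utilityRange) :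
    M.optimalPrice u ∈ M.prices := Ioo_subset_Icc_self (hU.interior u hu)

/-- Prices between a given one and the optimal one raise the revenue. -/
theorem revenue_le_of_mem_uIcc (hU : M.SmoothUnimodal) {u p p' : ℝ} (hu : u ∈ M.utilityRange)
    (hp : p ∈ M.prices) (hp' : p' ∈ uIcc (M.optimalPrice u) p) :
    M.revenue u p ≤ M.revenue u p' := by
  have hq := hU.interior u hu
  rcases mem_uIcc.mp hp' with h | h
  · exact hU.decreasing u hu ⟨h.1, h.2.trans hp.2⟩ ⟨h.1.trans h.2, hp.2⟩ h.2
  · exact hU.increasing u hu ⟨hp.1, h.1.trans h.2⟩ ⟨hp.1.trans h.1, h.2⟩ h.1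

theorem mem_prices_of_mem_uIcc (hU : M.SmoothUnimodal) {u p p' : ℝ} (hu : u ∈ M.utilityRange)
    (hp : p ∈ M.prices) (hp' : p' ∈ uIcc (M.optimalPrice u) p) : p' ∈ M.prices :=
  uIcc_subset_Icc (optimalPrice_mem hU hu) hp hp'

/-- Functions of the utility that agree almost surely agree on the support. -/
theorem eqOn_of_ae_eq {g h : ℝ → ℝ} (hg : ContinuousOn g M.utilityRange)
    (hh : ContinuousOn h M.utilityRange)
    (hae : ∀ᵐ x ∂M.contextLaw, g (M.utility x) = h (M.utility x)) : EqOn g h M.utilityRange := by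
  intro u hu
  by_contra hne
  obtain ⟨U, hUo, huU, hU⟩ := mem_nhdsWithin.mp
    (((hg u hu).sub (hh u hu)).eventually_ne (sub_ne_zero.mpr hne))
  obtain ⟨x, hx, hx', hx''⟩ := ((frequently_utility_mem hu hUo huU).and_eventually
    (hae.and ae_utility_mem_utilityRange)).exists
  exact hU ⟨hx, hx''⟩ (sub_eq_zero.mpr hx')

theorem isRigid_of_isOptimalFair (hB : M.Bounded) (hU : M.SmoothUnimodal) (hS : M.Stochastic)
    {δ : ℝ} (hδ : 0 ≤ δ) {ϖ : ℝ → ℝ} (hϖ : ϖ ∈ M.fairClass δ)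
    (hopt : M.IsOptimalFair δ (fun x => ϖ (M.utility x)))
    (huniq : ∀ π, M.IsOptimalFair δ π → ∀ᵐ x ∂M.contextLaw, π x = ϖ (M.utility x))
    {a b : ℝ} (hab : a ≤ b) (hI : M.utilityRange = Icc a b) :
    IsRigid a b δ M.optimalPrice ϖ := by
  intro g hg hgm
  rw [← hI] at hgm
  have hgp : ∀ u ∈ M.utilityRange, g u ∈ M.prices := fun u hu =>
    mem_prices_of_mem_uIcc hU hu (hϖ.1 u hu) (hgm u hu)
  have hgc : ContinuousOn g M.utilityRange :=
    hI ▸ (IsRigid.lipschitzOnWith hδ hg).continuousOn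
  have hϖc : ContinuousOn ϖ M.utilityRange := by
    have := hϖ.2
    rw [hI] at this ⊢
    exact (IsRigid.lipschitzOnWith hδ this).continuousOn
  have hmem : ∀ u, (projIcc a b hab u : ℝ) ∈ M.utilityRange := fun u => by
    rw [hI]; exact Subtype.prop _
  have hproj : ∀ u ∈ M.utilityRange, (projIcc a b hab u : ℝ) = u := fun u hu => by
    rw [projIcc_of_mem hab (hI ▸ hu)]
  -- Fairness concerns every context, even one whose utility lies outside the support, so `g` is
  -- extended by constants through `projIcc`.
  have hfair : M.IsUtilityFair δ (fun x => g (projIcc a b hab (M.utility x))) := by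
    refine ⟨fun x _ => hgp _ (hmem _), fun x _ y _ => ?_⟩
    refine (hg _ (Subtype.prop _) _ (Subtype.prop _)).trans ?_
    exact mul_le_mul_of_nonneg_left (abs_projIcc_sub_projIcc hab) hδ
  have hle : M.expectedRevenue (fun x => ϖ (M.utility x)) ≤
      M.expectedRevenue (fun x => g (projIcc a b hab (M.utility x))) := by
    have hcongr : M.expectedRevenue (fun x => g (projIcc a b hab (M.utility x))) =
        M.expectedRevenue (fun x => g (M.utility x)) := by
      refine integral_congr_ae ?_
      filter_upwards [ae_utility_mem_utilityRange (M := M)] with x hx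
      simp only [hproj _ hx]
    rw [hcongr]
    refine integral_mono_ae
      (integrable_comp_utility hS (continuousOn_revenue hB hU hS hϖc hϖ.1))
      (integrable_comp_utility hS (continuousOn_revenue hB hU hS hgc hgp)) ?_
    filter_upwards [ae_utility_mem_utilityRange (M := M)] with x hx
    exact revenue_le_of_mem_uIcc hU hx (hϖ.1 _ hx) (hgm _ hx)
  have hae := huniq _ ⟨hfair, fun π' hπ' => (hopt.2 π' hπ').trans hle⟩
  rw [← hI]
  refine eqOn_of_ae_eq hgc hϖc ?_
  filter_upwards [hae, ae_utility_mem_utilityRange (M := M)] with x hx hx'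
  rwa [hproj _ hx'] at hx

/-! ### The marginal revenue as a function of price and utility -/

/-- The marginal revenue `∂ₚ r_u(p)`. -/
noncomputable def marginalRevenue (M : PricingModel d) (u p : ℝ) : ℝ :=
  M.link (u - M.α₀ * p) - M.α₀ * p * derivWithin M.link M.linkDomain (u - M.α₀ * p)

theorem contexts_nonempty (hS : M.Stochastic) : M.contexts.Nonempty := by
  have := hS.isProbabilityMeasure
  obtain ⟨x, hx⟩ := hS.ae_mem.exists
  exact ⟨x, hx⟩

/-- Two different prices give two different link arguments. Nondegeneracy makes derivatives within
the link domain unique. -/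
theorem neg_Btilde_lt_Btilde (hB : M.Bounded) (hS : M.Stochastic) : -M.Btilde < M.Btilde := by
  obtain ⟨x, hx⟩ := contexts_nonempty hS
  have h1 := hB.link_arg_mem x hx M.pLow (left_mem_Icc.mpr hB.pLow_lt_pHigh.le)
  have h2 := hB.link_arg_mem x hx M.pHigh (right_mem_Icc.mpr hB.pLow_lt_pHigh.le)
  have := mul_lt_mul_of_pos_left hB.pLow_lt_pHigh hB.α₀_pos
  linarith [h1.2, h2.1]

theorem hasDerivWithinAt_link (hU : M.SmoothUnimodal) {v : ℝ}
    (hv : v ∈ M.linkDomain) :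
    HasDerivWithinAt M.link (derivWithin M.link M.linkDomain v) M.linkDomain v :=
  (hU.contDiffOn.differentiableOn (by norm_num) v hv).hasDerivWithinAt

theorem hasDerivWithinAt_derivWithin_link (hB : M.Bounded) (hU : M.SmoothUnimodal)
    (hS : M.Stochastic) {v : ℝ} (hv : v ∈ M.linkDomain) :
    HasDerivWithinAt (derivWithin M.link M.linkDomain)
      (iteratedDerivWithin 2 M.link M.linkDomain v) M.linkDomain v := by
  have h := ((hU.contDiffOn.derivWithin (m := 1)
    (uniqueDiffOn_Icc (neg_Btilde_lt_Btilde hB hS)) (by norm_num)).differentiableOn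
      (by norm_num) v hv).hasDerivWithinAt
  rwa [show iteratedDerivWithin 2 M.link M.linkDomain v =
    derivWithin (derivWithin M.link M.linkDomain) M.linkDomain v by
      rw [iteratedDerivWithin_succ, iteratedDerivWithin_one]]

theorem hasDerivWithinAt_link_arg (u p : ℝ) (s : Set ℝ) :
    HasDerivWithinAt (fun p => u - M.α₀ * p) (-M.α₀) s p := by
  simpa using (((hasDerivAt_id p).const_mul M.α₀).const_sub u).hasDerivWithinAt (s := s)

theorem hasDerivWithinAt_revenue (hB : M.Bounded) (hU : M.SmoothUnimodal) (hS : M.Stochastic)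
    {u p : ℝ} (hu : u ∈ M.utilityRange) (hp : p ∈ M.prices) :
    HasDerivWithinAt (M.revenue u) (M.marginalRevenue u p) M.prices p := by
  have hmaps : MapsTo (fun p => u - M.α₀ * p) M.prices M.linkDomain :=
    fun p hp => link_arg_mem_of_mem_utilityRange hB hS hu hp
  have h := (hasDerivWithinAt_id p M.prices).mul ((hasDerivWithinAt_link hU (hmaps hp)).comp p
    (hasDerivWithinAt_link_arg u p M.prices) hmaps)
  refine h.congr_deriv ?_
  simp only [Function.comp, marginalRevenue, id]
  ring

theorem hasDerivWithinAt_marginalRevenue (hB : M.Bounded) (hU : M.SmoothUnimodal)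
    (hS : M.Stochastic) {u p : ℝ} (hu : u ∈ M.utilityRange) (hp : p ∈ M.prices) :
    HasDerivWithinAt (M.marginalRevenue u)
      (-2 * M.α₀ * derivWithin M.link M.linkDomain (u - M.α₀ * p) +
        M.α₀ ^ 2 * p * iteratedDerivWithin 2 M.link M.linkDomain (u - M.α₀ * p)) M.prices p := by
  have hmaps : MapsTo (fun p => u - M.α₀ * p) M.prices M.linkDomain :=
    fun p hp => link_arg_mem_of_mem_utilityRange hB hS hu hp
  have h := ((hasDerivWithinAt_link hU (hmaps hp)).comp p
    (hasDerivWithinAt_link_arg u p M.prices) hmaps).sub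
      (((hasDerivWithinAt_id p M.prices).const_mul M.α₀).mul
        ((hasDerivWithinAt_derivWithin_link hB hU hS (hmaps hp)).comp p
          (hasDerivWithinAt_link_arg u p M.prices) hmaps))
  refine h.congr_deriv ?_
  simp only [Function.comp, id]
  ring

theorem hasDerivWithinAt_marginalRevenue_utility (hB : M.Bounded) (hU : M.SmoothUnimodal)
    (hS : M.Stochastic) {u p : ℝ} (hu : u ∈ M.utilityRange) (hp : p ∈ M.prices) :
    HasDerivWithinAt (fun u => M.marginalRevenue u p)
      (derivWithin M.link M.linkDomain (u - M.α₀ * p) -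
        M.α₀ * p * iteratedDerivWithin 2 M.link M.linkDomain (u - M.α₀ * p)) M.utilityRange u := by
  have hmaps : MapsTo (fun u => u - M.α₀ * p) M.utilityRange M.linkDomain :=
    fun u hu => link_arg_mem_of_mem_utilityRange hB hS hu hp
  have harg : HasDerivWithinAt (fun u => u - M.α₀ * p) 1 M.utilityRange u :=
    (hasDerivWithinAt_id u M.utilityRange).sub_const _
  have h := ((hasDerivWithinAt_link hU (hmaps hu)).comp u harg hmaps).sub
    (((hasDerivWithinAt_derivWithin_link hB hU hS (hmaps hu)).comp u harg hmaps).const_mul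
      (M.α₀ * p))
  refine h.congr_deriv ?_
  ring

theorem iteratedDerivWithin_two_revenue (hB : M.Bounded) (hU : M.SmoothUnimodal)
    (hS : M.Stochastic) {u p : ℝ} (hu : u ∈ M.utilityRange) (hp : p ∈ M.prices) :
    iteratedDerivWithin 2 (M.revenue u) M.prices p =
      -2 * M.α₀ * derivWithin M.link M.linkDomain (u - M.α₀ * p) +
        M.α₀ ^ 2 * p * iteratedDerivWithin 2 M.link M.linkDomain (u - M.α₀ * p) := by
  have hud : UniqueDiffOn ℝ M.prices := uniqueDiffOn_Icc hB.pLow_lt_pHigh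
  have heq : EqOn (derivWithin (M.revenue u) M.prices) (M.marginalRevenue u) M.prices :=
    fun q hq => (hasDerivWithinAt_revenue hB hU hS hu hq).derivWithin (hud q hq)
  rw [iteratedDerivWithin_succ, iteratedDerivWithin_one, derivWithin_congr heq (heq hp)]
  exact (hasDerivWithinAt_marginalRevenue hB hU hS hu hp).derivWithin (hud p hp)

theorem nonneg_and_le_one_of_mem_prices (hB : M.Bounded) {p : ℝ} (hp : p ∈ M.prices) : 0 ≤ p ∧ p ≤ 1 :=
  ⟨hB.pLow_nonneg.trans hp.1, hp.2.trans hB.pHigh_le_one⟩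

theorem abs_iteratedDerivWithin_two_revenue_le_Mr (hB : M.Bounded) (hU : M.SmoothUnimodal)
    (hS : M.Stochastic) {u p : ℝ} (hu : u ∈ M.utilityRange) (hp : p ∈ M.prices) :
    |iteratedDerivWithin 2 (M.revenue u) M.prices p| ≤ M.Mr := by
  obtain ⟨L, hL⟩ := hU.bounded
  have hα := hB.α₀_pos
  have hbdd : ∀ v ∈ M.utilityRange, ∀ q ∈ M.prices,
      |iteratedDerivWithin 2 (M.revenue v) M.prices q| ≤ 2 * M.α₀ * L + M.α₀ ^ 2 * L := by
    intro v hv q hq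
    obtain ⟨-, h1, h2⟩ := hL _ (link_arg_mem_of_mem_utilityRange hB hS hv hq)
    obtain ⟨hq0, hq1⟩ := nonneg_and_le_one_of_mem_prices hB hq
    rw [iteratedDerivWithin_two_revenue hB hU hS hv hq]
    generalize derivWithin M.link M.linkDomain (v - M.α₀ * q) = x at h1 ⊢
    generalize iteratedDerivWithin 2 M.link M.linkDomain (v - M.α₀ * q) = y at h2 ⊢
    refine (abs_add_le _ _).trans (add_le_add ?_ ?_)
    · rw [abs_mul, abs_mul, abs_of_pos hα, abs_neg, abs_of_pos two_pos]
      exact mul_le_mul_of_nonneg_left h1 (by positivity)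
    · rw [abs_mul, abs_mul, abs_of_nonneg hq0, abs_of_nonneg (sq_nonneg M.α₀)]
      exact mul_le_mul (mul_le_of_le_one_right (sq_nonneg _) hq1) h2 (abs_nonneg _) (sq_nonneg _)
  rw [Mr]
  refine le_csSup ?_ ?_
  · refine ⟨2 * M.α₀ * L + M.α₀ ^ 2 * L, ?_⟩
    rintro _ ⟨q, hq, rfl⟩
    exact hbdd q.1 hq.1 q.2 hq.2
  · exact ⟨(u, p), ⟨hu, hp⟩, rfl⟩

theorem abs_marginalRevenue_sub_le (hB : M.Bounded) (hU : M.SmoothUnimodal)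
    (hS : M.Stochastic) {u p q : ℝ} (hu : u ∈ M.utilityRange) (hp : p ∈ M.prices)
    (hq : q ∈ M.prices) :
    |M.marginalRevenue u q - M.marginalRevenue u p| ≤ M.Mr * |q - p| :=
  Convex.norm_image_sub_le_of_norm_hasDerivWithin_le
    (fun _ hx => hasDerivWithinAt_marginalRevenue hB hU hS hu hx)
    (fun x hx => by
      rw [← iteratedDerivWithin_two_revenue hB hU hS hu hx]
      exact abs_iteratedDerivWithin_two_revenue_le_Mr hB hU hS hu hx)
    (convex_Icc _ _) hp hq

theorem sigmaU_le (hB : M.Bounded) (hU : M.SmoothUnimodal) {v p : ℝ}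
    (hv : v ∈ M.linkDomain) (hp : p ∈ M.prices) :
    M.sigmaU ≤ derivWithin M.link M.linkDomain v -
      M.α₀ * p * iteratedDerivWithin 2 M.link M.linkDomain v := by
  obtain ⟨L, hL⟩ := hU.bounded
  have hα := hB.α₀_pos
  obtain ⟨hp0, -⟩ := nonneg_and_le_one_of_mem_prices hB hp
  have hph : 0 ≤ M.pHigh := hp0.trans hp.2
  refine (csInf_le ⟨-L - M.α₀ * M.pHigh * L, ?_⟩ (mem_image_of_mem _ hv)).trans ?_
  · rintro _ ⟨w, hw, rfl⟩
    obtain ⟨-, h1, h2⟩ := hL w hw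
    have h3 : M.α₀ * M.pHigh * |iteratedDerivWithin 2 M.link M.linkDomain w| ≤
      M.α₀ * M.pHigh * L := by gcongr
    have h4 := (abs_le.mp h1).1
    linarith
  · refine sub_le_sub_left ?_ _
    calc M.α₀ * p * iteratedDerivWithin 2 M.link M.linkDomain v
        ≤ M.α₀ * p * |iteratedDerivWithin 2 M.link M.linkDomain v| := by
          gcongr; exact le_abs_self _
      _ ≤ _ := by
          gcongr; exact hp.2

theorem sigmaU_mul_le_marginalRevenue_sub (hB : M.Bounded) (hU : M.SmoothUnimodal)
    (hS : M.Stochastic) {u v p : ℝ} (hu : u ∈ M.utilityRange) (hv : v ∈ M.utilityRange)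
    (huv : u ≤ v) (hp : p ∈ M.prices) :
    M.sigmaU * (v - u) ≤ M.marginalRevenue v p - M.marginalRevenue u p := by
  obtain ⟨a, b, -, hI, -⟩ := hS.support_eq
  have hd : ∀ w ∈ M.utilityRange, HasDerivWithinAt
      (fun w => M.marginalRevenue w p - M.sigmaU * w)
      (derivWithin M.link M.linkDomain (w - M.α₀ * p) -
        M.α₀ * p * iteratedDerivWithin 2 M.link M.linkDomain (w - M.α₀ * p) - M.sigmaU)
      M.utilityRange w := fun w hw => by
    have h := (hasDerivWithinAt_marginalRevenue_utility hB hU hS hw hp).sub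
      ((hasDerivWithinAt_id w M.utilityRange).const_mul M.sigmaU)
    rw [mul_one] at h
    exact h
  have hmono := monotoneOn_of_hasDerivWithinAt_nonneg (hI ▸ convex_Icc a b)
    (fun w hw => (hd w hw).continuousWithinAt)
    (fun w hw => (hd w (interior_subset hw)).mono interior_subset)
    (fun w hw => sub_nonneg.mpr (sigmaU_le hB hU
      (link_arg_mem_of_mem_utilityRange hB hS (interior_subset hw) hp) hp))
  have := hmono hu hv huv
  simp only at this
  linarith

/-! ### Growth and continuity of the optimal price -/

theorem marginalRevenue_optimalPrice (hB : M.Bounded) (hU : M.SmoothUnimodal)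
    (hS : M.Stochastic) {u : ℝ} (hu : u ∈ M.utilityRange) :
    M.marginalRevenue u (M.optimalPrice u) = 0 := by
  have hq := hU.interior u hu
  have hnhds : M.prices ∈ nhds (M.optimalPrice u) := Icc_mem_nhds hq.1 hq.2
  refine IsLocalMax.hasDerivAt_eq_zero (f := M.revenue u) (a := M.optimalPrice u) ?_
    ((hasDerivWithinAt_revenue hB hU hS hu (optimalPrice_mem hU hu)).hasDerivAt hnhds)
  filter_upwards [hnhds] with p hp
  exact revenue_le_of_mem_uIcc hU hu hp left_mem_uIcc

theorem optimalPrice_lt_optimalPrice (hB : M.Bounded) (hU : M.SmoothUnimodal)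
    (hS : M.Stochastic) (hσ : 0 < M.sigmaU) {u v : ℝ} (hu : u ∈ M.utilityRange)
    (hv : v ∈ M.utilityRange) (huv : u < v) : M.optimalPrice u < M.optimalPrice v := by
  by_contra! hle
  have hp := optimalPrice_mem hU hu
  have h1 := sigmaU_mul_le_marginalRevenue_sub hB hU hS hu hv huv.le hp
  rw [marginalRevenue_optimalPrice hB hU hS hu, sub_zero] at h1
  have h2 : 0 < M.sigmaU * (v - u) := mul_pos hσ (sub_pos.mpr huv)
  -- Right of `p*(u) ≥ p*(v)` the revenue `r_v` is non-increasing, so its marginal value at `p*(u)`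
  -- is at most `0`, against the lower bound `σ_u (v - u) > 0`.
  have hsub : Icc (M.optimalPrice u) M.pHigh ⊆ Icc (M.optimalPrice v) M.pHigh :=
    Icc_subset_Icc_left hle
  have h3 := ((hU.decreasing v hv).mono hsub).derivWithin_nonpos (x := M.optimalPrice u)
  rw [((hasDerivWithinAt_revenue hB hU hS hv hp).mono (Icc_subset_Icc_left hp.1)).derivWithin
    (uniqueDiffOn_Icc (hU.interior u hu).2 _ (left_mem_Icc.mpr hp.2))] at h3
  linarith

theorem monotoneOn_optimalPrice (hB : M.Bounded) (hU : M.SmoothUnimodal)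
    (hS : M.Stochastic) (hσ : 0 < M.sigmaU) : MonotoneOn M.optimalPrice M.utilityRange :=
  StrictMonoOn.monotoneOn fun _ hu _ hv huv => optimalPrice_lt_optimalPrice hB hU hS hσ hu hv huv

/-- An implicit differentiation in difference form: the marginal revenue of `v` is at least `σ_u (v
- u)` at `p*(u)` and zero at `p*(v)`, and it is `M_r`-Lipschitz in between. -/
theorem sigmaU_mul_le_optimalPrice_sub (hB : M.Bounded) (hU : M.SmoothUnimodal)
    (hS : M.Stochastic) (hσ : 0 < M.sigmaU) {u v : ℝ} (hu : u ∈ M.utilityRange)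
    (hv : v ∈ M.utilityRange) (huv : u ≤ v) :
    M.sigmaU * (v - u) ≤ M.Mr * (M.optimalPrice v - M.optimalPrice u) := by
  have hp := optimalPrice_mem hU hu
  have h1 := sigmaU_mul_le_marginalRevenue_sub hB hU hS hu hv huv hp
  have h2 := (neg_abs_le _).trans' (neg_le_neg (abs_marginalRevenue_sub_le hB hU hS hv hp
    (optimalPrice_mem hU hv)))
  rw [marginalRevenue_optimalPrice hB hU hS hu] at h1
  rw [marginalRevenue_optimalPrice hB hU hS hv,
    abs_of_nonneg (sub_nonneg.mpr (monotoneOn_optimalPrice hB hU hS hσ hu hv huv))] at h2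
  linarith

theorem abs_revenue_sub_le (hB : M.Bounded) (hS : M.Stochastic)
    (hU : M.SmoothUnimodal) : ∃ L : ℝ, ∀ u ∈ M.utilityRange, ∀ v ∈ M.utilityRange,
      ∀ p ∈ M.prices, |M.revenue u p - M.revenue v p| ≤ L * |u - v| := by
  obtain ⟨L, hL⟩ := hU.bounded
  refine ⟨L, fun u hu v hv p hp => ?_⟩
  obtain ⟨hp0, hp1⟩ := nonneg_and_le_one_of_mem_prices hB hp
  have h := Convex.norm_image_sub_le_of_norm_hasDerivWithin_le
    (fun w hw => hasDerivWithinAt_link (M := M) hU hw) (fun w hw => (hL w hw).2.1)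
    (convex_Icc _ _) (link_arg_mem_of_mem_utilityRange hB hS hv hp)
    (link_arg_mem_of_mem_utilityRange hB hS hu hp)
  rw [sub_sub_sub_cancel_right, Real.norm_eq_abs, Real.norm_eq_abs] at h
  rw [revenue, revenue, ← mul_sub, abs_mul, abs_of_nonneg hp0]
  exact (mul_le_of_le_one_left (abs_nonneg _) hp1).trans h

theorem continuousOn_optimalPrice (hB : M.Bounded) (hU : M.SmoothUnimodal)
    (hS : M.Stochastic) : ContinuousOn M.optimalPrice M.utilityRange := by
  obtain ⟨L, hL⟩ := abs_revenue_sub_le hB hS hU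
  obtain ⟨σ, hσ, hdec⟩ := hU.decay
  intro u hu
  -- Adding the decay inequality of `u` at `p*(v)` to that of `v` at `p*(u)` leaves differences of
  -- revenue in the utility only, bounded by `2 L |u - v|`; so `p*` is Hölder of order `1/2`.
  have key : ∀ v ∈ M.utilityRange,
      |M.optimalPrice v - M.optimalPrice u| ≤ √(2 * L / σ * |u - v|) := by
    intro v hv
    have hp := optimalPrice_mem hU hu
    have hq := optimalPrice_mem hU hv
    refine Real.abs_le_sqrt ?_
    have h1 := hdec u hu _ hq
    have h2 := hdec v hv _ hp
    have h3 := (le_abs_self _).trans (hL u hu v hv _ hp)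
    have h4 := (neg_abs_le _).trans' (neg_le_neg (hL u hu v hv _ hq))
    rw [div_mul_eq_mul_div, le_div_iff₀ hσ]
    linarith
  refine tendsto_iff_dist_tendsto_zero.mpr ?_
  have hlim : Filter.Tendsto (fun v => √(2 * L / σ * |u - v|)) (nhdsWithin u M.utilityRange)
      (nhds 0) := by
    have hc : Continuous fun v => √(2 * L / σ * |u - v|) := by fun_prop
    simpa using (hc.tendsto u).mono_left nhdsWithin_le_nhds
  refine squeeze_zero' (Filter.Eventually.of_forall fun _ => dist_nonneg) ?_ hlim
  filter_upwards [self_mem_nhdsWithin] with v hv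
  exact key v hv

end PricingModel

/-! ### Assembly of the theorem -/

theorem mainTheorem3 {d : ℕ} (M : PricingModel d)
    (hBounded : M.Bounded) (hSmooth : M.SmoothUnimodal) (hStochastic : M.Stochastic)
    (hσ : 0 < M.sigmaU) (δ₀ : ℝ) (hδ₀ : 0 < δ₀)
    (ϖ : ℝ → ℝ) (hϖ : ϖ ∈ M.fairClass δ₀)
    (hopt : M.IsOptimalFair δ₀ (fun x => ϖ (M.utility x)))
    (huniq : ∀ π, M.IsOptimalFair δ₀ π → ∀ᵐ x ∂M.contextLaw, π x = ϖ (M.utility x)) :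
    MonotoneOn ϖ M.utilityRange ∧
    (∀ᵐ u ∂(volume.restrict M.utilityRange), DifferentiableAt ℝ ϖ u) ∧
    (∀ u ∈ interior M.utilityRange, DifferentiableAt ℝ ϖ u → deriv ϖ u < δ₀ →
      ϖ u = M.optimalPrice u) ∧
    (δ₀ ≤ M.sigmaU / M.Mr →
      ∃ π₀ : ℝ, (∀ u ∈ M.utilityRange, ϖ u = π₀ + δ₀ * u) ∧
        (0 ∈ M.utilityRange → π₀ = ϖ 0 ∧ π₀ ∈ M.prices)) := by
  obtain ⟨a, b, hab, hI, -⟩ := hStochastic.support_eq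
  have hrigid := PricingModel.isRigid_of_isOptimalFair hBounded hSmooth hStochastic hδ₀.le hϖ hopt
    huniq hab hI
  have hLip := hϖ.2
  have hq := PricingModel.monotoneOn_optimalPrice hBounded hSmooth hStochastic hσ
  have hqc := PricingModel.continuousOn_optimalPrice hBounded hSmooth hStochastic
  have hqs := fun u hu v hv =>
    PricingModel.sigmaU_mul_le_optimalPrice_sub hBounded hSmooth hStochastic hσ (u := u) (v := v)
      hu hv
  have hprices := hϖ.1
  rw [hI] at hLip hq hqc hprices ⊢
  refine ⟨hrigid.monotoneOn hδ₀.le hLip hq hqc, ?_, fun u hu hd hlt => ?_, fun hδM => ?_⟩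
  -- The endpoints are null, and at interior points differentiability within the interval, almost
  -- everywhere by Rademacher, is differentiability.
  · rw [← restrict_Ioo_eq_restrict_Icc, ae_restrict_iff' measurableSet_Ioo]
    filter_upwards [(IsRigid.lipschitzOnWith hδ₀.le hLip).ae_differentiableWithinAt_of_mem]
      with u h hu
    exact (h (Ioo_subset_Icc_self hu)).differentiableAt (Icc_mem_nhds hu.1 hu.2)
  · rw [interior_Icc] at hu
    exact hrigid.eq_of_deriv_lt hδ₀.le hLip hq hqc hu hd.hasDerivAt hlt
  -- If `M.Mr ≤ 0`, the quotient is at most `0` (division by zero gives `0`), contradicting `0 <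
  -- δ₀`.
  · have hMr : 0 < M.Mr := by
      by_contra! h
      linarith [div_nonpos_of_nonneg_of_nonpos hσ.le h]
    have hslope : ∀ u ∈ Icc a b, ∀ v ∈ Icc a b, u ≤ v →
        δ₀ * (v - u) ≤ M.optimalPrice v - M.optimalPrice u := by
      intro u hu v hv huv
      rw [← hI] at hu hv
      have h1 := hqs u hu v hv huv
      have h2 := mul_le_mul_of_nonneg_right ((le_div_iff₀ hMr).mp hδM) (sub_nonneg.mpr huv)
      refine le_of_mul_le_mul_left ?_ hMr
      linarith
    obtain ⟨c, hc⟩ := hrigid.eq_affine hδ₀.le hLip hab hslope hqc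
    refine ⟨c, hc, fun h0 => ?_⟩
    have hc0 : c = ϖ 0 := by simpa using (hc 0 h0).symm
    exact ⟨hc0, hc0 ▸ hprices 0 h0⟩
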